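/- Let $\mathsf{Seq}$ be the first-order theory in the language $\{e,\vdash,\circ\}$ ($e$ a constant symbol, $\vdash$ and $\circ$ binary function symbols) with the axioms 1. $\forall x y\,[\,x\vdash y\neq e\,]$, 2. $\forall x_1x_2y_1y_2\,[\,x_1\vdash x_2=y_1\vdash y_2\rightarrow(x_1=y_1\wedge x_2=y_2)\,]$, 3. $\forall x\,[\,x\circ e=x\,]$, 4. $\forall xyz\,[\,x\circ(y\vdash z)=(x\circ y)\vdash z\,]$, 5. $\forall x\,[\,x=e\vee\exists yz\,[x=y\vdash z]\,]$. Let $\mathsf{Seq}^+$ be $\mathsf{Seq}$ together with the axioms 6. $\forall x\,[\,x\circ e=x\wedge e\circ x=x\,]$, 7. $\forall xyzw\,[\,x\circ y=z\circ w\leftrightarrow\exists u\,[(z=x\circ u\wedge u\circ w=y)\vee(x=z\circ u\wedge u\circ y=w)]\,]$, 8. $\forall xyz\,[\,(x\circ y=x\circ z\vee y\circ x=z\circ x)\rightarrow y=z\,]$. Let $\mathsf{T}$ be the first-order theory in the language $\{\bot,\langle\cdot,\cdot\rangle,\sqsubseteq\}$ ($\bot$ a constant symbol, $\langle\cdot,\cdot\rangle$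 a binary function symbol, $\sqsubseteq$ a binary relation symbol) with the axioms - $\mathsf{T}_1$: $\forall xy\,[\,\langle x,y\rangle\neq\bot\,]$, - $\mathsf{T}_2$: $\forall x_1x_2y_1y_2\,[\,\langle x_1,x_2\rangle=\langle y_1,y_2\rangle\rightarrow(x_1=y_1\wedge x_2=y_2)\,]$, - $\mathsf{T}_3$: $\forall x\,[\,x\sqsubseteq\bot\leftrightarrow x=\bot\,]$, - $\mathsf{T}_4$: $\forall xyz\,[\,x\sqsubseteq\langle y,z\rangle\leftrightarrow(x=\langle y,z\rangle\vee x\sqsubseteq y\vee x\sqsubseteq z)\,]$. A theory $A$ is interpretable in a theory $B$ if there is a one-dimensional, parameter-free relative translation $\tau$ (a domain formula with one free variable, and a formula of the language of $B$ for each relation symbol and for the graph of each function symbol of the language of $A$; equality is translated as equality, connectives are preserved, quantifiers are restricted to the domain) such that $B$ proves that the domain is non-empty, that each function symbol is translated into a total function on the domain, and the translation $\varphi^\tau$ of each axiom $\varphi$ of $A$. (By the completeness theorem, "$B$ proves" means "holds in every model of $B$".) **Theorem.** $\mathsf{T}$ is interpretable in $\mathsf{Seq}^+$, and $\mathsf{T}$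 is also interpretable in $\mathsf{Seq}$. -/

import Mathlib

/-! ### Relative interpretations between first-order theories -/

namespace FirstOrder.Language

universe u v u' v'

/-- A (one-dimensional, parameter-free) relative translation of the language `L` into `L'`:
a domain formula with one free variable, for each `n`-ary function symbol an `L'`-formula for the
graph of the function (arguments `Sum.inl i`, value `Sum.inr ()`), and for each `n`-ary relation
symbol an `L'`-formula with `n` free variables. Equality is translated as equality. -/
structure Translation (L : Language.{u, v}) (L' : Language.{u', v'}) where
  dom : L'.Formula Unit
  func : ∀ {n : ℕ}, L.Functions n → L'.Formula (Fin n ⊕ Unit)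
  rel : ∀ {n : ℕ}, L.Relations n → L'.Formula (Fin n)

namespace Translation

variable {L : Language.{u, v}} {L' : Language.{u', v'}} {α : Type}

/-- The formula "`x` belongs to the domain". -/
def domAt (τ : Translation L L') (x : α) : L'.Formula α :=
  τ.dom.relabel fun _ => x

/-- Existential quantification, restricted to the domain, over the variables indexed by `β`. -/
noncomputable def exDom (τ : Translation L L') (β : Type) [Finite β]
    (φ : L'.Formula (α ⊕ β)) : L'.Formula α :=
  Formula.iExs β ((Formula.iInf fun b : β => τ.domAt (Sum.inr b)) ⊓ φ)

/-- Universal quantification, restricted to the domain, over the variables indexed by `β`. -/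
noncomputable def allDom (τ : Translation L L') (β : Type) [Finite β]
    (φ : L'.Formula (α ⊕ β)) : L'.Formula α :=
  Formula.iAlls β ((Formula.iInf fun b : β => τ.domAt (Sum.inr b)).imp φ)

/-- The formula "the translation of the term `t` has the value `Sum.inr ()`". -/
noncomputable def termGraph (τ : Translation L L') : L.Term α → L'.Formula (α ⊕ Unit)
  | .var x => Term.equal (.var (Sum.inl x)) (.var (Sum.inr ()))
  | .func (l := n) f ts =>
      τ.exDom (Fin n)
        ((Formula.iInf fun i : Fin n =>
            (τ.termGraph (ts i)).relabel (Sum.map Sum.inl fun _ => i)) ⊓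
          (τ.func f).relabel (Sum.elim Sum.inr fun _ => Sum.inl (Sum.inr ())))

/-- The translation of a formula. It commutes with the connectives and restricts the quantifiers
to the domain; atomic formulas are unnested by means of `termGraph`. -/
noncomputable def form (τ : Translation L L') :
    ∀ {n : ℕ}, L.BoundedFormula α n → L'.Formula (α ⊕ Fin n)
  | _, .falsum => ⊥
  | _, .equal s t => τ.exDom Unit (τ.termGraph s ⊓ τ.termGraph t)
  | _, .rel (l := l) R ts =>
      τ.exDom (Fin l)
        ((Formula.iInf fun i : Fin l =>
            (τ.termGraph (ts i)).relabel (Sum.map id fun _ => i)) ⊓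
          (τ.rel R).relabel Sum.inr)
  | _, .imp φ ψ => (τ.form φ).imp (τ.form ψ)
  | n, .all φ =>
      τ.allDom Unit ((τ.form φ).relabel
        (Sum.elim (fun a => Sum.inl (Sum.inl a))
          (Fin.snoc (fun i : Fin n => Sum.inl (Sum.inr i)) (Sum.inr ()))))

/-- The translation of a sentence. -/
noncomputable def sentence (τ : Translation L L') (φ : L.Sentence) : L'.Sentence :=
  (τ.form φ).relabel (Sum.elim id Fin.elim0)

/-- The `L'`-sentence "the domain is non-empty". -/
noncomputable def domNonempty (τ : Translation L L') : L'.Sentence :=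
  Formula.iExs Unit (τ.domAt (Sum.inr ()) : L'.Formula (Empty ⊕ Unit))

/-- The `L'`-sentence "for all arguments in the domain there is a unique value of `f` in the
domain". -/
noncomputable def funcTotal (τ : Translation L L') {n : ℕ} (f : L.Functions n) : L'.Sentence :=
  τ.allDom (α := Empty) (Fin n)
    (Formula.iExsUnique Unit
      (τ.domAt (Sum.inr ()) ⊓ (τ.func f).relabel (Sum.map Sum.inr id)))

/-- `τ` is an interpretation of the theory `T` in the theory `S`: the theory `S` proves that the
domain is non-empty, that the function symbols are translated into functions on the domain, and
the translation of each axiom of `T`. -/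
structure IsInterpretation (τ : Translation L L') (T : L.Theory) (S : L'.Theory) : Prop where
  domNonempty : S ⊨ᵇ τ.domNonempty
  funcTotal : ∀ {n : ℕ} (f : L.Functions n), S ⊨ᵇ τ.funcTotal f
  translated : ∀ φ ∈ T, S ⊨ᵇ τ.sentence φ

end Translation

/-- The theory `T` is interpretable in the theory `S`. -/
def Theory.InterpretableIn {L : Language.{u, v}} {L' : Language.{u', v'}}
    (T : L.Theory) (S : L'.Theory) : Prop :=
  ∃ τ : Translation L L', τ.IsInterpretation T S

end FirstOrder.Language

/-! ### The theories of sequences -/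

namespace SeqTheory

open FirstOrder FirstOrder.Language

/-- The function symbols `e`, `⊢` (append an element) and `∘` (concatenation). -/
inductive SeqFunc : ℕ → Type
  | e : SeqFunc 0
  | app : SeqFunc 2
  | conc : SeqFunc 2

/-- The language `{e, ⊢, ∘}`. -/
def LSeq : FirstOrder.Language.{0, 0} := ⟨SeqFunc, fun _ => Empty⟩

/-- The symbols, with the type `LSeq.Functions n` instead of `SeqFunc n`. -/
abbrev eSymb : LSeq.Functions 0 := SeqFunc.e

abbrev appSymb : LSeq.Functions 2 := SeqFunc.app

abbrev concSymb : LSeq.Functions 2 := SeqFunc.conc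

/-- The constant `e`. -/
def e {α : Type} : LSeq.Term α := Constants.term eSymb

/-- The term `x ⊢ y`. -/
def app {α : Type} (x y : LSeq.Term α) : LSeq.Term α :=
  appSymb.apply₂ x y

/-- The term `x ∘ y`. -/
def conc {α : Type} (x y : LSeq.Term α) : LSeq.Term α :=
  concSymb.apply₂ x y

/-- `∀ x y, x ⊢ y ≠ e` -/
def seq1 : LSeq.Sentence := ∀' ∀' ∼(app (&0) (&1) =' e)

/-- `∀ x₁ x₂ y₁ y₂, x₁ ⊢ x₂ = y₁ ⊢ y₂ → x₁ = y₁ ∧ x₂ = y₂` -/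
def seq2 : LSeq.Sentence :=
  ∀' ∀' ∀' ∀' ((app (&0) (&1) =' app (&2) (&3)) ⟹ ((&0 =' &2) ⊓ (&1 =' &3)))

/-- `∀ x, x ∘ e = x` -/
def seq3 : LSeq.Sentence := ∀' (conc (&0) e =' &0)

/-- `∀ x y z, x ∘ (y ⊢ z) = (x ∘ y) ⊢ z` -/
def seq4 : LSeq.Sentence :=
  ∀' ∀' ∀' (conc (&0) (app (&1) (&2)) =' app (conc (&0) (&1)) (&2))

/-- `∀ x, x = e ∨ ∃ y z, x = y ⊢ z` -/
def seq5 : LSeq.Sentence := ∀' ((&0 =' e) ⊔ ∃' ∃' (&0 =' app (&1) (&2)))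

/-- The theory `Seq`. -/
def Seq : LSeq.Theory := {seq1, seq2, seq3, seq4, seq5}

/-- `∀ x, x ∘ e = x ∧ e ∘ x = x` -/
def seqStar3 : LSeq.Sentence := ∀' ((conc (&0) e =' &0) ⊓ (conc e (&0) =' &0))

/-- `∀ x y z w, x ∘ y = z ∘ w ↔ ∃ u, (z = x ∘ u ∧ u ∘ w = y) ∨ (x = z ∘ u ∧ u ∘ y = w)` -/
def seqStar5 : LSeq.Sentence :=
  ∀' ∀' ∀' ∀' ((conc (&0) (&1) =' conc (&2) (&3)) ⇔
    ∃' (((&2 =' conc (&0) (&4)) ⊓ (conc (&4) (&3) =' &1)) ⊔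
        ((&0 =' conc (&2) (&4)) ⊓ (conc (&4) (&1) =' &3))))

/-- `∀ x y z, (x ∘ y = x ∘ z ∨ y ∘ x = z ∘ x) → y = z` -/
def seqCancel : LSeq.Sentence :=
  ∀' ∀' ∀' (((conc (&0) (&1) =' conc (&0) (&2)) ⊔ (conc (&1) (&0) =' conc (&2) (&0))) ⟹
    (&1 =' &2))

/-- The theory `Seq⁺`. -/
def SeqPlus : LSeq.Theory :=
  {seq1, seq2, seq3, seq4, seq5, seqStar3, seqStar5, seqCancel}

/-! ### The tree theory -/

/-- The function symbols `⊥` and `⟨·,·⟩`. -/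
inductive TreeFunc : ℕ → Type
  | bot : TreeFunc 0
  | pair : TreeFunc 2

/-- The relation symbol `⊑`. -/
inductive TreeRel : ℕ → Type
  | sub : TreeRel 2

/-- The language `{⊥, ⟨·,·⟩, ⊑}`. -/
def LTree : FirstOrder.Language.{0, 0} := ⟨TreeFunc, TreeRel⟩

/-- The symbols, with types `LTree.Functions n` and `LTree.Relations n`. -/
abbrev botSymb : LTree.Functions 0 := TreeFunc.bot

abbrev pairSymb : LTree.Functions 2 := TreeFunc.pair

abbrev subSymb : LTree.Relations 2 := TreeRel.sub

/-- The constant `⊥`. -/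
def bot {α : Type} : LTree.Term α := Constants.term botSymb

/-- The term `⟨x, y⟩`. -/
def pair {α : Type} (x y : LTree.Term α) : LTree.Term α :=
  pairSymb.apply₂ x y

/-- The formula `x ⊑ y`. -/
def sub {α : Type} {n : ℕ} (x y : LTree.Term (α ⊕ Fin n)) : LTree.BoundedFormula α n :=
  subSymb.boundedFormula₂ x y

/-- `∀ x y, ⟨x, y⟩ ≠ ⊥` -/
def tree1 : LTree.Sentence := ∀' ∀' ∼(pair (&0) (&1) =' bot)

/-- `∀ x₁ x₂ y₁ y₂, ⟨x₁, x₂⟩ = ⟨y₁, y₂⟩ → x₁ = y₁ ∧ x₂ = y₂` -/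
def tree2 : LTree.Sentence :=
  ∀' ∀' ∀' ∀' ((pair (&0) (&1) =' pair (&2) (&3)) ⟹ ((&0 =' &2) ⊓ (&1 =' &3)))

/-- `∀ x, x ⊑ ⊥ ↔ x = ⊥` -/
def tree3 : LTree.Sentence := ∀' (sub (&0) bot ⇔ (&0 =' bot))

/-- `∀ x y z, x ⊑ ⟨y, z⟩ ↔ x = ⟨y, z⟩ ∨ x ⊑ y ∨ x ⊑ z` -/
def tree4 : LTree.Sentence :=
  ∀' ∀' ∀' (sub (&0) (pair (&1) (&2)) ⇔
    ((&0 =' pair (&1) (&2)) ⊔ (sub (&0) (&1) ⊔ sub (&0) (&2))))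

/-- The tree theory `T`. -/
def TreeT : LTree.Theory := {tree1, tree2, tree3, tree4}

end SeqTheory

/-!
Since `Seq ⊆ SeqPlus`, it is enough to interpret the tree theory in `Seq`.

Put `x ∈ s` when `s = (u ⊢ x) ∘ v` for some `u` and `v`. In every model of `Seq` the sequence `e`
has no members, and the members of `s ⊢ w` are `w` and the members of `s` (`mem_app_iff`), so
sequences serve as finite sets. There is no induction, hence neither associativity of `∘` nor the
fact that `s ∘ t` has the members of `s` and `t` is available for all `t`; but the class of the
*tame* `t`, for which both hold with arbitrary arguments on the left, contains `e` and is closed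
under `⊢` and `∘` (`tame_app`, `tame_conc`).

Translate `⊥` as `e` and `⟨x, y⟩` as `x ⊢ y`, on the whole universe, and `x ⊑ y` as "`x` is a member
of every tame sequence that has `y` as a member and whose set of members is closed under
`a ⊢ b ↦ a, b`". The first two axioms on trees are then axioms of `Seq`, and `x ⊑ ⊥ ↔ x = ⊥` holds
because the one-element sequence `e ⊢ e` is such a closed tame sequence. For the nontrivial
direction of the last axiom, suppose that `x ≠ ⟨y, z⟩`, that `s` refutes `x ⊑ y`, and that `t`
refutes `x ⊑ z`; then `(s ∘ t) ⊢ ⟨y, z⟩` refutes `x ⊑ ⟨y, z⟩` (`sub_app_iff`).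
-/

/-! ### Semantics of translations with trivial domain -/

namespace FirstOrder.Language.Translation

universe u v u' v' w

variable {L : Language.{u, v}} {L' : Language.{u', v'}} {α : Type}
variable {M : Type w} [L.Structure M] [L'.Structure M]

/-- The `L`-structure on `M` is the one that the translation `τ` defines, on the whole universe,
in the `L'`-structure on `M`. -/
structure Defines (τ : Translation L L') (M : Type w) [L.Structure M] [L'.Structure M] :
    Prop where
  dom : ∀ v : Unit → M, τ.dom.Realize v
  func : ∀ {n : ℕ} (f : L.Functions n) (v : Fin n ⊕ Unit → M),
    (τ.func f).Realize v ↔ Structure.funMap f (v ∘ Sum.inl) = v (Sum.inr ())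
  rel : ∀ {n : ℕ} (R : L.Relations n) (v : Fin n → M),
    (τ.rel R).Realize v ↔ Structure.RelMap R v

namespace Defines

variable {τ : Translation L L'}

theorem realize_domAt (h : τ.Defines M) (x : α) (v : α → M) : (τ.domAt x).Realize v := by
  simp only [domAt, Formula.realize_relabel]
  exact h.dom _

theorem realize_exDom (h : τ.Defines M) {β : Type} [Finite β] (φ : L'.Formula (α ⊕ β))
    (v : α → M) : (τ.exDom β φ).Realize v ↔ ∃ x : β → M, φ.Realize (Sum.elim v x) := by
  simp [exDom, Formula.realize_iExs, h.realize_domAt]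

theorem realize_allDom (h : τ.Defines M) {β : Type} [Finite β] (φ : L'.Formula (α ⊕ β))
    (v : α → M) : (τ.allDom β φ).Realize v ↔ ∀ x : β → M, φ.Realize (Sum.elim v x) := by
  simp [allDom, Formula.realize_iAlls, h.realize_domAt]

theorem realize_termGraph (h : τ.Defines M) (t : L.Term α) (v : α ⊕ Unit → M) :
    (τ.termGraph t).Realize v ↔ t.realize (v ∘ Sum.inl) = v (Sum.inr ()) := by
  induction t generalizing v with
  | var x => simp [termGraph]
  | func f ts ih =>
    simp only [termGraph, h.realize_exDom, Formula.realize_inf, Formula.realize_iInf,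
      Formula.realize_relabel, ih, h.func, Term.realize_func]
    constructor
    · rintro ⟨x, hx, hf⟩
      rw [show (fun i => (ts i).realize (v ∘ Sum.inl)) = x from funext hx]
      exact hf
    · intro hf
      exact ⟨_, fun i => rfl, hf⟩

theorem realize_form (h : τ.Defines M) {n : ℕ} (φ : L.BoundedFormula α n)
    (v : α ⊕ Fin n → M) :
    (τ.form φ).Realize v ↔ φ.Realize (v ∘ Sum.inl) (v ∘ Sum.inr) := by
  induction φ with
  | falsum => simp [form, BoundedFormula.Realize]
  | equal s t =>
    simp only [form, h.realize_exDom, Formula.realize_inf, h.realize_termGraph,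
      BoundedFormula.Realize, Sum.elim_comp_inl, Sum.elim_inr, Sum.elim_comp_inl_inr]
    exact ⟨fun ⟨x, hs, ht⟩ => hs.trans ht.symm, fun hst => ⟨fun _ => _, hst, rfl⟩⟩
  | rel R ts =>
    simp only [form, h.realize_exDom, Formula.realize_inf, Formula.realize_iInf,
      Formula.realize_relabel, h.realize_termGraph, h.rel, BoundedFormula.Realize,
      Sum.elim_comp_inl_inr]
    constructor
    · rintro ⟨x, hx, hR⟩
      rw [show (fun i => (ts i).realize v) = x from funext hx]
      exact hR
    · intro hR
      exact ⟨_, fun i => rfl, hR⟩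
  | imp φ ψ ihφ ihψ =>
    simp only [form, Formula.realize_imp, ihφ, ihψ, BoundedFormula.realize_imp]
  | @all n φ ih =>
    simp only [form, h.realize_allDom, Formula.realize_relabel, ih, BoundedFormula.realize_all]
    have key : ∀ x : Unit → M,
        (Sum.elim v x ∘ Sum.elim (fun a => Sum.inl (Sum.inl a))
          (Fin.snoc (fun i : Fin n => Sum.inl (Sum.inr i)) (Sum.inr ()))) ∘ Sum.inr =
          (Fin.snoc (v ∘ Sum.inr) (x ()) : Fin (n + 1) → M) := by
      intro x
      funext i
      refine Fin.lastCases ?_ (fun i => ?_) i <;> simp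
    simp only [key]
    exact ⟨fun H a => H fun _ => a, fun H x => H (x ())⟩

theorem realize_sentence (h : τ.Defines M) (φ : L.Sentence) : M ⊨ τ.sentence φ ↔ M ⊨ φ := by
  rw [Sentence.Realize, sentence, Formula.realize_relabel, h.realize_form, Sentence.Realize,
    Formula.Realize]
  exact iff_of_eq (congrArg₂ _ (Subsingleton.elim _ _) (Subsingleton.elim _ _))

theorem realize_domNonempty [Nonempty M] (h : τ.Defines M) : M ⊨ τ.domNonempty := by
  simp only [Sentence.Realize, domNonempty, Formula.realize_iExs]
  exact ⟨fun _ => Classical.arbitrary M, h.realize_domAt _ _⟩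

theorem realize_funcTotal (h : τ.Defines M) {n : ℕ} (f : L.Functions n) :
    M ⊨ τ.funcTotal f := by
  simp only [Sentence.Realize, funcTotal, h.realize_allDom, Formula.realize_iExsUnique,
    Formula.realize_inf, h.realize_domAt, true_and, Formula.realize_relabel, h.func]
  intro x
  refine ⟨fun _ => Structure.funMap f x, rfl, fun y hy => ?_⟩
  funext _
  exact hy.symm

end Defines

/-- A translation is an interpretation as soon as every model of the target theory carries a model
of the source theory that the translation defines on the whole universe. -/
theorem isInterpretation_of_defines {τ : Translation L L'} {T : L.Theory} {S : L'.Theory}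
    (h : ∀ M : Theory.ModelType.{u', v', max u' v'} S, ∃ _ : L.Structure M, τ.Defines M ∧ M ⊨ T) :
    τ.IsInterpretation T S where
  domNonempty := Theory.models_sentence_iff.2 fun M => by
    obtain ⟨_, hM, -⟩ := h M
    exact hM.realize_domNonempty
  funcTotal f := Theory.models_sentence_iff.2 fun M => by
    obtain ⟨_, hM, -⟩ := h M
    exact hM.realize_funcTotal f
  translated φ hφ := Theory.models_sentence_iff.2 fun M => by
    obtain ⟨_, hM, hT⟩ := h M
    exact (hM.realize_sentence φ).2 (hT.realize_of_mem φ hφ)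

end FirstOrder.Language.Translation

theorem FirstOrder.Language.Theory.InterpretableIn.mono {L : Language} {L' : Language}
    {T : L.Theory} {S S' : L'.Theory} (h : T.InterpretableIn S) (hS : S ⊆ S') :
    T.InterpretableIn S' := by
  obtain ⟨τ, hτ⟩ := h
  have mono : ∀ φ : L'.Sentence, S ⊨ᵇ φ → S' ⊨ᵇ φ := fun φ hφ =>
    Theory.models_sentence_iff.2 fun M =>
      haveI := M.is_model.mono hS
      hφ.realize_sentence M
  exact ⟨τ, mono _ hτ.domNonempty, fun f => mono _ (hτ.funcTotal f),
    fun φ hφ => mono _ (hτ.translated φ hφ)⟩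

/-! ### Trees inside a model of `Seq` -/

namespace SeqTheory

open FirstOrder FirstOrder.Language

/-- The axioms of `Seq`, for an element and two operations on a type. -/
structure SeqModel {M : Type*} (e : M) (app conc : M → M → M) : Prop where
  app_ne : ∀ x y, app x y ≠ e
  app_inj : ∀ {x₁ x₂ y₁ y₂}, app x₁ x₂ = app y₁ y₂ → x₁ = y₁ ∧ x₂ = y₂
  conc_e : ∀ x, conc x e = x
  conc_app : ∀ x y z, conc x (app y z) = app (conc x y) z
  cases : ∀ x, x = e ∨ ∃ y z, x = app y z

section Operations

variable {M : Type*} (app conc : M → M → M)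

/-- `x` is an entry of the sequence `s`. -/
def Mem (x s : M) : Prop := ∃ u v, s = conc (app u x) v

/-- Concatenation with `t` on the right is associative and adds exactly the members of `t`. -/
def Tame (t : M) : Prop :=
  (∀ s r, conc s (conc r t) = conc (conc s r) t) ∧
    ∀ s z, Mem app conc z (conc s t) ↔ Mem app conc z s ∨ Mem app conc z t

/-- The members of `s` are closed under taking both components of a pair `a ⊢ b`. -/
def Closed (s : M) : Prop :=
  ∀ a b, Mem app conc (app a b) s → Mem app conc a s ∧ Mem app conc b s

/-- `x` belongs to every closed tame sequence to which `y` belongs. In a nonstandard model there may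
be no such sequence for some `y`; every `x` is then a subtree of `y`, which the axioms on trees
allow. -/
def IsSub (x y : M) : Prop :=
  ∀ s, Tame app conc s → Closed app conc s → Mem app conc y s → Mem app conc x s

end Operations

namespace SeqModel

variable {M : Type*} {e : M} {app conc : M → M → M} (h : SeqModel e app conc)
include h

theorem not_mem_e (x : M) : ¬ Mem app conc x e := by
  rintro ⟨u, v, huv⟩
  obtain rfl | ⟨v, w, rfl⟩ := h.cases v
  · rw [h.conc_e] at huv
    exact h.app_ne _ _ huv.symm
  · rw [h.conc_app] at huv
    exact h.app_ne _ _ huv.symm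

theorem mem_app_iff {x s w : M} : Mem app conc x (app s w) ↔ x = w ∨ Mem app conc x s := by
  constructor
  · rintro ⟨u, v, huv⟩
    obtain rfl | ⟨v, w', rfl⟩ := h.cases v
    · rw [h.conc_e] at huv
      exact .inl (h.app_inj huv).2.symm
    · rw [h.conc_app] at huv
      exact .inr ⟨u, v, (h.app_inj huv).1⟩
  · rintro (rfl | ⟨u, v, rfl⟩)
    · exact ⟨s, e, (h.conc_e _).symm⟩
    · exact ⟨u, app v w, (h.conc_app _ _ _).symm⟩

theorem tame_e : Tame app conc e := by
  refine ⟨fun s r => ?_, fun s z => ?_⟩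
  · rw [h.conc_e, h.conc_e]
  · simp only [h.conc_e, h.not_mem_e, or_false]

theorem tame_app {t : M} (ht : Tame app conc t) (w : M) : Tame app conc (app t w) := by
  refine ⟨fun s r => ?_, fun s z => ?_⟩
  · rw [h.conc_app, h.conc_app, h.conc_app, ht.1]
  · rw [h.conc_app, h.mem_app_iff, h.mem_app_iff, ht.2]
    tauto

omit h in
theorem tame_conc {t t' : M} (ht : Tame app conc t) (ht' : Tame app conc t') :
    Tame app conc (conc t t') := by
  refine ⟨fun s r => ?_, fun s z => ?_⟩
  · rw [ht'.1, ht'.1, ht.1, ht'.1]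
  · rw [ht'.1, ht'.2, ht.2, ht'.2, or_assoc]

theorem sub_e_iff {x : M} : IsSub app conc x e ↔ x = e := by
  constructor
  · intro hx
    have hmem := hx (app e e) (h.tame_app h.tame_e e) (fun a b hab => by
      simp [h.mem_app_iff, h.not_mem_e, h.app_ne] at hab) (h.mem_app_iff.2 (.inl rfl))
    simpa [h.mem_app_iff, h.not_mem_e] using hmem
  · rintro rfl s - - hs
    exact hs

theorem sub_app_iff {x y z : M} :
    IsSub app conc x (app y z) ↔ x = app y z ∨ IsSub app conc x y ∨ IsSub app conc x z := by
  constructor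
  · intro hx
    by_contra! hcon
    obtain ⟨hne, hy, hz⟩ := hcon
    simp only [IsSub, not_forall] at hy hz
    obtain ⟨s, hs, hsc, hys, hxs⟩ := hy
    obtain ⟨t, ht, htc, hzt, hxt⟩ := hz
    have hmem : ∀ a, Mem app conc a (app (conc s t) (app y z)) ↔
        a = app y z ∨ Mem app conc a s ∨ Mem app conc a t := fun a => by
      rw [h.mem_app_iff, ht.2]
    have hc : Closed app conc (app (conc s t) (app y z)) := by
      intro a b hab
      simp only [hmem] at hab ⊢
      rcases hab with hab | hab | hab
      · obtain ⟨rfl, rfl⟩ := h.app_inj hab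
        exact ⟨.inr (.inl hys), .inr (.inr hzt)⟩
      · exact ⟨.inr (.inl (hsc a b hab).1), .inr (.inl (hsc a b hab).2)⟩
      · exact ⟨.inr (.inr (htc a b hab).1), .inr (.inr (htc a b hab).2)⟩
    have := (hmem x).1 (hx _ (h.tame_app (tame_conc hs ht) _) hc ((hmem _).2 (.inl rfl)))
    tauto
  · rintro (rfl | hx | hx) s hs hc hyz
    · exact hyz
    · exact hx s hs hc (hc _ _ hyz).1
    · exact hx s hs hc (hc _ _ hyz).2

end SeqModel

/-! ### The defining formulas -/

section Formulas

variable {α : Type} {n : ℕ}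

/-- A term, regarded as a term in one more bound variable. -/
def lift (t : LSeq.Term (α ⊕ Fin n)) : LSeq.Term (α ⊕ Fin (n + 1)) :=
  t.relabel (Sum.map id Fin.castSucc)

/-- The newest of `n + 1` bound variables. -/
def newVar : LSeq.Term (α ⊕ Fin (n + 1)) := .var (Sum.inr (Fin.last n))

/-- The formula saying that `x` is an entry of `s`. -/
def memFormula (x s : LSeq.Term (α ⊕ Fin n)) : LSeq.BoundedFormula α n :=
  ∃' ∃' (lift (lift s) =' conc (app (lift newVar) (lift (lift x))) newVar)

/-- The formula saying that `t` is tame. -/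
def tameFormula (t : LSeq.Term (α ⊕ Fin n)) : LSeq.BoundedFormula α n :=
  (∀' ∀' (conc (lift newVar) (conc newVar (lift (lift t))) ='
    conc (conc (lift newVar) newVar) (lift (lift t)))) ⊓
  ∀' ∀' (memFormula newVar (conc (lift newVar) (lift (lift t))) ⇔
    (memFormula newVar (lift newVar) ⊔ memFormula newVar (lift (lift t))))

/-- The formula saying that the members of `s` are closed under components. -/
def closedFormula (s : LSeq.Term (α ⊕ Fin n)) : LSeq.BoundedFormula α n :=
  ∀' ∀' (memFormula (app (lift newVar) newVar) (lift (lift s)) ⟹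
    (memFormula (lift newVar) (lift (lift s)) ⊓ memFormula newVar (lift (lift s))))

/-- The formula saying that `x` belongs to every closed tame sequence to which `y` belongs. -/
def subFormula (x y : LSeq.Term (α ⊕ Fin n)) : LSeq.BoundedFormula α n :=
  ∀' (tameFormula newVar ⟹ closedFormula newVar ⟹
    memFormula (lift y) newVar ⟹ memFormula (lift x) newVar)

variable {M : Type*} [LSeq.Structure M]

/-- The interpretation of `e`. -/
def eVal (M : Type*) [LSeq.Structure M] : M := Structure.funMap eSymb ![]

/-- The interpretation of `⊢`. -/
def appVal (x y : M) : M := Structure.funMap appSymb ![x, y]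

/-- The interpretation of `∘`. -/
def concVal (x y : M) : M := Structure.funMap concSymb ![x, y]

@[simp] theorem realize_e (v : α → M) : (e : LSeq.Term α).realize v = eVal M := by
  simp only [e, Constants.term, Term.realize_func, eVal]
  congr 1
  exact Subsingleton.elim _ _

@[simp] theorem realize_app (s t : LSeq.Term α) (v : α → M) :
    (app s t).realize v = appVal (s.realize v) (t.realize v) :=
  Term.realize_functions_apply₂

@[simp] theorem realize_conc (s t : LSeq.Term α) (v : α → M) :
    (conc s t).realize v = concVal (s.realize v) (t.realize v) :=
  Term.realize_functions_apply₂

@[simp] theorem realize_lift (t : LSeq.Term (α ⊕ Fin n)) (v : α → M) (xs : Fin n → M) (a : M) :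
    (lift t).realize (Sum.elim v (Fin.snoc xs a)) = t.realize (Sum.elim v xs) := by
  rw [lift, Term.realize_relabel]
  congr 1
  funext i
  rcases i with i | i <;> simp

@[simp] theorem realize_newVar (v : α → M) (xs : Fin n → M) (a : M) :
    (newVar : LSeq.Term (α ⊕ Fin (n + 1))).realize (Sum.elim v (Fin.snoc xs a)) = a := by
  simp [newVar]

@[simp] theorem realize_memFormula (x s : LSeq.Term (α ⊕ Fin n)) (v : α → M) (xs : Fin n → M) :
    (memFormula x s).Realize v xs ↔ Mem appVal concVal
      (x.realize (Sum.elim v xs)) (s.realize (Sum.elim v xs)) := by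
  simp [memFormula, Mem]

@[simp] theorem realize_tameFormula (t : LSeq.Term (α ⊕ Fin n)) (v : α → M) (xs : Fin n → M) :
    (tameFormula t).Realize v xs ↔ Tame appVal concVal (t.realize (Sum.elim v xs)) := by
  simp [tameFormula, Tame]

@[simp] theorem realize_closedFormula (s : LSeq.Term (α ⊕ Fin n)) (v : α → M)
    (xs : Fin n → M) :
    (closedFormula s).Realize v xs ↔ Closed appVal concVal (s.realize (Sum.elim v xs)) := by
  simp [closedFormula, Closed]

@[simp] theorem realize_subFormula (x y : LSeq.Term (α ⊕ Fin n)) (v : α → M) (xs : Fin n → M) :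
    (subFormula x y).Realize v xs ↔ IsSub appVal concVal
      (x.realize (Sum.elim v xs)) (y.realize (Sum.elim v xs)) := by
  simp [subFormula, IsSub]

end Formulas

/-! ### The interpretation -/

/-- The graphs of `⊥` and `⟨·,·⟩`. -/
def treeFuncFormula : ∀ {n : ℕ}, TreeFunc n → LSeq.Formula (Fin n ⊕ Unit)
  | _, .bot => Term.equal e (.var (Sum.inr ()))
  | _, .pair => Term.equal (app (.var (Sum.inl 0)) (.var (Sum.inl 1))) (.var (Sum.inr ()))

/-- The defining formula of `⊑`. -/
def treeRelFormula : ∀ {n : ℕ}, TreeRel n → LSeq.Formula (Fin n)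
  | _, .sub => subFormula (.var (Sum.inl 0)) (.var (Sum.inl 1))

/-- Trees are translated as arbitrary sequences, with `⊥` as `e`, `⟨x, y⟩` as `x ⊢ y` and `⊑` as
`IsSub`. -/
def treeTranslation : Translation LTree LSeq where
  dom := ⊤
  func := treeFuncFormula
  rel := treeRelFormula

section Models

variable (M : Type*) [LSeq.Structure M]

/-- The values of `⊥` and `⟨·,·⟩` in a structure for the language of sequences. -/
def treeFunMap : ∀ {n : ℕ}, TreeFunc n → (Fin n → M) → M
  | _, .bot, _ => eVal M
  | _, .pair, x => appVal (x 0) (x 1)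

/-- The relation `⊑` in a structure for the language of sequences. -/
def treeRelMap : ∀ {n : ℕ}, TreeRel n → (Fin n → M) → Prop
  | _, .sub, x => IsSub appVal concVal (x 0) (x 1)

/-- The trees of a structure for the language of sequences. -/
abbrev treeStructure : LTree.Structure M where
  funMap := treeFunMap M
  RelMap := treeRelMap M

theorem treeTranslation_defines :
    letI := treeStructure M
    treeTranslation.Defines M := by
  let _ := treeStructure M
  refine ⟨fun v => ?_, fun f v => ?_, fun R v => ?_⟩
  · exact Formula.realize_top.2 trivial
  · cases f <;> simp [treeTranslation, treeFuncFormula, treeFunMap, Structure.funMap]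
  · cases R
    simp [treeTranslation, treeRelFormula, treeRelMap, Structure.RelMap, Formula.Realize]

theorem seqModel_of_model [M ⊨ Seq] : SeqModel (eVal M) appVal concVal := by
  have h : ∀ φ ∈ Seq, M ⊨ φ := fun φ hφ => Theory.realize_sentence_of_mem Seq hφ
  simp only [Seq, Set.mem_insert_iff, Set.mem_singleton_iff, forall_eq_or_imp, forall_eq] at h
  obtain ⟨h1, h2, h3, h4, h5⟩ := h
  simp [Sentence.Realize, Formula.Realize, seq1, Fin.snoc] at h1
  simp [Sentence.Realize, Formula.Realize, seq2, Fin.snoc] at h2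
  simp [Sentence.Realize, Formula.Realize, seq3, Fin.snoc] at h3
  simp [Sentence.Realize, Formula.Realize, seq4, Fin.snoc] at h4
  simp [Sentence.Realize, Formula.Realize, seq5, Fin.snoc] at h5
  exact ⟨h1, fun h => h2 _ _ _ _ h, h3, h4, h5⟩

theorem treeStructure_models [M ⊨ Seq] :
    letI := treeStructure M
    M ⊨ TreeT := by
  let _ := treeStructure M
  have h := seqModel_of_model M
  have hbot : ∀ {α : Type} (v : α → M), (bot : LTree.Term α).realize v = eVal M :=
    fun v => rfl
  have hpair : ∀ {α : Type} (s t : LTree.Term α) (v : α → M),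
      (pair s t).realize v = appVal (s.realize v) (t.realize v) :=
    fun s t v => rfl
  have hsub : ∀ {α : Type} {n : ℕ} (s t : LTree.Term (α ⊕ Fin n)) (v : α → M) (xs : Fin n → M),
      (sub s t).Realize v xs ↔
        IsSub appVal concVal (s.realize (Sum.elim v xs)) (t.realize (Sum.elim v xs)) :=
    fun s t v xs => Iff.rfl
  refine ⟨fun φ hφ => ?_⟩
  simp only [TreeT, Set.mem_insert_iff, Set.mem_singleton_iff] at hφ
  rcases hφ with rfl | rfl | rfl | rfl
  · simpa [Sentence.Realize, Formula.Realize, tree1, Fin.snoc, hbot, hpair] using h.app_ne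
  · simpa [Sentence.Realize, Formula.Realize, tree2, Fin.snoc, hpair] using
      fun _ _ _ _ => h.app_inj
  · simpa [Sentence.Realize, Formula.Realize, tree3, Fin.snoc, hbot, hsub] using
      fun _ => h.sub_e_iff
  · simpa [Sentence.Realize, Formula.Realize, tree4, Fin.snoc, hpair, hsub] using
      fun _ _ _ => h.sub_app_iff

end Models

theorem treeT_interpretableIn_seq : TreeT.InterpretableIn Seq :=
  ⟨treeTranslation, Translation.isInterpretation_of_defines fun M =>
    ⟨treeStructure M, treeTranslation_defines M, treeStructure_models M⟩⟩

theorem seq_subset_seqPlus : Seq ⊆ SeqPlus := by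
  intro φ hφ
  simp only [Seq, SeqPlus, Set.mem_insert_iff, Set.mem_singleton_iff] at hφ ⊢
  tauto

end SeqTheory

theorem mainTheorem2 :
    FirstOrder.Language.Theory.InterpretableIn SeqTheory.TreeT SeqTheory.SeqPlus ∧
      FirstOrder.Language.Theory.InterpretableIn SeqTheory.TreeT SeqTheory.Seq :=
  ⟨SeqTheory.treeT_interpretableIn_seq.mono SeqTheory.seq_subset_seqPlus,
    SeqTheory.treeT_interpretableIn_seq⟩
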